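/- Let $I=[0,1]$, $N\ge 0$ an integer, and let $L^2(I,\mathbb{R}^N)$ carry its usual distance $d(q_1,q_2)=\left(\int_0^1|q_1(t)-q_2(t)|^2\,dt\right)^{1/2}$. Let $\Gamma$ be the group of absolutely continuous functions $\gamma:I\to I$ with $\gamma(0)=0$, $\gamma(1)=1$ and $\gamma'(t)>0$ for almost every $t$; it acts on $L^2(I,\mathbb{R}^N)$ from the right by $(q*\gamma)(t)=\sqrt{\gamma'(t)}\,q(\gamma(t))$. Write $q\Gamma=\{q*\gamma:\gamma\in\Gamma\}$ for the orbit of $q$, and let $q_1\sim q_2$ mean that $q_1\Gamma$ and $q_2\Gamma$ have the same closure in $L^2(I,\mathbb{R}^N)$. Let $\mathcal S(I,\mathbb{R}^N)=L^2(I,\mathbb{R}^N)/\sim$, let $[q]$ be the class of $q$, and put $$d([q_1],[q_2])=\inf_{w_1\in[q_1],\,w_2\in[q_2]}d(w_1,w_2).$$ Let $\mathcal S_{st}(I,\mathbb{R}^N)\subset\mathcal S(I,\mathbb{R}^N)$ be the set of the classes that contain at least one step function, that is, a function which for some $0=t_0<t_1<\dots<t_n=1$ is almost everywhere constant on each interval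 $(t_{j-1},t_j)$. Theorem. Let $[q]\in\mathcal S(I,\mathbb{R}^N)$ and $[w]\in\mathcal S_{st}(I,\mathbb{R}^N)$. Then there exist $\tilde q\in[q]$ and $\tilde w\in[w]$ such that $d(\tilde q,\tilde w)=d([q],[w])$; that is, the infimum that defines $d([q],[w])$ is attained. -/

import Mathlib

open scoped ENNReal

noncomputable section

namespace SRVF

/-- The space `L²(I, ℝᴺ)`, `I = [0,1]`, with its usual `L²` norm and distance. -/
abbrev L2 (N : ℕ) : Type :=
  MeasureTheory.Lp (EuclideanSpace ℝ (Fin N)) 2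
    (MeasureTheory.volume.restrict (Set.Icc (0 : ℝ) 1))

/-- The group `Γ` of reparametrizations of `I = [0,1]`. A map `I → I` is given by a function on `ℝ`
of which only the values on `[0,1]` matter. -/
structure IsReparam (γ : ℝ → ℝ) : Prop where
  mapsTo : Set.MapsTo γ (Set.Icc 0 1) (Set.Icc 0 1)
  absCont : AbsolutelyContinuousOnInterval γ 0 1
  map_zero : γ 0 = 0
  map_one : γ 1 = 1
  deriv_pos : ∀ᵐ t ∂(MeasureTheory.volume.restrict (Set.Icc (0 : ℝ) 1)), 0 < deriv γ t

/-- The function `(q * γ)(t) = √(γ'(t)) q(γ(t))`. -/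
def act {N : ℕ} (q : ℝ → EuclideanSpace ℝ (Fin N)) (γ : ℝ → ℝ) :
    ℝ → EuclideanSpace ℝ (Fin N) :=
  fun t => Real.sqrt (deriv γ t) • q (γ t)

/-- The orbit `qΓ = {q * γ : γ ∈ Γ}` in `L²(I, ℝᴺ)`. -/
def orbit {N : ℕ} (q : L2 N) : Set (L2 N) :=
  {p | ∃ γ : ℝ → ℝ, IsReparam γ ∧
    (p : ℝ → EuclideanSpace ℝ (Fin N))
      =ᵐ[MeasureTheory.volume.restrict (Set.Icc (0 : ℝ) 1)] act q γ}

/-- `q₁ ∼ q₂` if and only if `q₁Γ` and `q₂Γ` have the same closure in `L²(I, ℝᴺ)`. -/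
def orbitSetoid (N : ℕ) : Setoid (L2 N) where
  r q₁ q₂ := closure (orbit q₁) = closure (orbit q₂)
  iseqv := ⟨fun _ => rfl, fun h => h.symm, fun h₁ h₂ => h₁.trans h₂⟩

/-- The quotient `𝒮(I, ℝᴺ) = L²(I, ℝᴺ)/∼`. -/
def ShapeSpace (N : ℕ) : Type := Quotient (orbitSetoid N)

/-- The point `[q]` of `𝒮(I, ℝᴺ)`. -/
def cls {N : ℕ} (q : L2 N) : ShapeSpace N := Quotient.mk (orbitSetoid N) q

/-- A point of `𝒮(I, ℝᴺ)` regarded as a subset of `L²(I, ℝᴺ)`. -/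
def ShapeSpace.carrier {N : ℕ} (x : ShapeSpace N) : Set (L2 N) := {q | cls q = x}

/-- `d(x, y) = inf {d(w₁, w₂) : w₁ ∈ x, w₂ ∈ y}`, an infimum of a nonempty set of nonnegative
real numbers. -/
def shapeDist {N : ℕ} (x y : ShapeSpace N) : ℝ :=
  sInf {r : ℝ | ∃ w₁ ∈ x.carrier, ∃ w₂ ∈ y.carrier, r = dist w₁ w₂}

/-- Step functions: there are `0 = t₀ < t₁ < ⋯ < tₙ = 1` such that `q` is (a.e.) constant on each
`(tⱼ₋₁, tⱼ)`. -/
def IsStep {N : ℕ} (q : L2 N) : Prop :=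
  ∃ (n : ℕ) (t : Fin (n + 1) → ℝ) (c : Fin n → EuclideanSpace ℝ (Fin N)),
    StrictMono t ∧ t 0 = 0 ∧ t (Fin.last n) = 1 ∧
    ∀ j : Fin n, ∀ᵐ s ∂(MeasureTheory.volume.restrict (Set.Ioo (t j.castSucc) (t j.succ))),
      q s = c j

/-- The subset `𝒮_st(I, ℝᴺ)` of the classes that contain at least one step function. -/
def stepShapes (N : ℕ) : Set (ShapeSpace N) := {x | ∃ q ∈ x.carrier, IsStep q}

end SRVF

end

namespace SRVF

open MeasureTheory Set Filter Topology

/-! Every element of a class lies in the closure of each orbit of that class, so it suffices to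
minimize the distance over the orbits, provided that the minimizers stay in the classes.
Reparametrizations act by isometries, so minimizing distance means maximizing the inner product of
`q * α` and `w * β`. The minimizers found are only weakly increasing reparametrizations. These are
encoded by their densities, that is, probability densities on `[0,1]` that may vanish on sets of
positive measure, and `closure_orbit_reparam` shows that they preserve the class.

Let the step function `w` have the value `c j` on the `j`-th interval, of length `ℓ j`. While `w`
runs through this interval, `q` runs through some interval `[s j, s (j+1)]`. Replacing `⟨q, c j⟩` by
its positive part and applying Cauchy–Schwarz bounds this contribution by the square root of `ℓ j`
times that of the integral of the squared positive part over `[s j, s (j+1)]` (`integral_inner_le`).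
The sum of these bounds is `matchValue`, a continuous function of the partition `s`. Partitions with
degenerate intervals allowed form a compact set, so a maximum exists, and
`exists_inner_eq_matchValue` realizes equality for any given `s`. -/

/-- The primitive `t ↦ ∫₀ᵗ g`. -/
noncomputable def prim (g : ℝ → ℝ) (t : ℝ) : ℝ := ∫ s in (0 : ℝ)..t, g s

/-- The measure with density `g`. -/
noncomputable def densMeas (g : ℝ → ℝ) : Measure ℝ :=
  volume.withDensity fun t => ENNReal.ofReal (g t)

/-- Probability densities on `[0,1]`. -/
structure IsDensity (g : ℝ → ℝ) : Prop where
  measurable : Measurable g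
  nonneg : ∀ t, 0 ≤ g t
  support : ∀ t ∉ Icc (0 : ℝ) 1, g t = 0
  lintegral_eq : ∫⁻ t, ENNReal.ofReal (g t) = 1

/-! ### Change of variables along the primitive of a nonnegative function -/

section Primitive

variable {g : ℝ → ℝ}

lemma prim_zero : prim g 0 = 0 := by simp [prim]

lemma continuous_prim (hi : Integrable g) : Continuous (prim g) :=
  intervalIntegral.continuous_primitive (fun _ _ => hi.intervalIntegrable) 0

lemma prim_sub (hi : Integrable g) (u v : ℝ) : prim g v - prim g u = ∫ s in u..v, g s :=
  intervalIntegral.integral_interval_sub_left hi.intervalIntegrable hi.intervalIntegrable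

lemma monotone_prim (h0 : ∀ t, 0 ≤ g t) (hi : Integrable g) : Monotone (prim g) := by
  intro u v huv
  have := prim_sub hi u v
  have h2 : 0 ≤ ∫ s in u..v, g s := intervalIntegral.integral_nonneg huv fun t _ => h0 t
  linarith

lemma densMeas_Ioc (h0 : ∀ t, 0 ≤ g t) (hi : Integrable g) {u v : ℝ} (huv : u ≤ v) :
    densMeas g (Ioc u v) = ENNReal.ofReal (prim g v - prim g u) := by
  rw [densMeas, withDensity_apply _ measurableSet_Ioc, prim_sub hi,
    intervalIntegral.integral_of_le huv,
    ofReal_integral_eq_lintegral_ofReal hi.integrableOn (Eventually.of_forall h0)]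

lemma isFiniteMeasure_densMeas (hi : Integrable g) : IsFiniteMeasure (densMeas g) :=
  isFiniteMeasure_withDensity_ofReal hi.2

/-- The change of variables formula for the primitive of a nonnegative function. -/
lemma map_prim_densMeas (h0 : ∀ t, 0 ≤ g t) (hi : Integrable g) {u v : ℝ} (huv : u ≤ v) :
    ((densMeas g).restrict (Ioc u v)).map (prim g)
      = volume.restrict (Ioc (prim g u) (prim g v)) := by
  have := isFiniteMeasure_densMeas hi
  have hmono := monotone_prim h0 hi
  have hcont := continuous_prim hi
  have : IsFiniteMeasure (volume.restrict (Ioc (prim g u) (prim g v))) := by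
    constructor; simp
  refine Measure.ext_of_Iic _ _ fun x => ?_
  rw [Measure.map_apply hcont.measurable measurableSet_Iic,
    Measure.restrict_apply (hcont.measurable measurableSet_Iic),
    Measure.restrict_apply measurableSet_Iic]
  rcases lt_or_ge x (prim g u) with hx | hx
  · have h1 : prim g ⁻¹' Iic x ∩ Ioc u v = ∅ := by
      ext t
      simp only [mem_inter_iff, mem_preimage, mem_Iic, mem_Ioc, mem_empty_iff_false, iff_false]
      rintro ⟨h, h2, -⟩
      exact absurd (hmono h2.le) (by linarith)
    have h2 : Iic x ∩ Ioc (prim g u) (prim g v) = ∅ := by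
      ext t
      simp only [mem_inter_iff, mem_Iic, mem_Ioc, mem_empty_iff_false, iff_false]
      rintro ⟨h, h2, -⟩
      linarith
    rw [h1, h2]; simp
  have hS : IsCompact (Icc u v ∩ prim g ⁻¹' Iic x) :=
    isCompact_Icc.inter_right (isClosed_Iic.preimage hcont)
  -- `prim g` need not be injective; the last point `r` at which it is at most `x` makes the
  -- preimage an interval with right end `r`.
  obtain ⟨r, ⟨⟨hur, hrv⟩, hrx⟩, hmax⟩ := hS.exists_isGreatest ⟨u, ⟨le_rfl, huv⟩, hx⟩
  have hset : prim g ⁻¹' Iic x ∩ Ioc u v = Ioc u r := by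
    ext t
    constructor
    · rintro ⟨h, h1, h2⟩
      exact ⟨h1, hmax ⟨⟨h1.le, h2⟩, h⟩⟩
    · rintro ⟨h1, h2⟩
      exact ⟨(hmono h2).trans hrx, h1, h2.trans hrv⟩
  have hr : prim g r = min x (prim g v) := by
    refine le_antisymm (le_min hrx (hmono hrv)) ?_
    obtain ⟨r', hr', h⟩ := intermediate_value_Icc huv hcont.continuousOn
      (show min x (prim g v) ∈ Icc (prim g u) (prim g v) from
        ⟨le_min hx (hmono huv), min_le_right _ _⟩)
    rw [← h]
    exact hmono (hmax ⟨hr', by simp [h]⟩)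
  have hset2 : Iic x ∩ Ioc (prim g u) (prim g v) = Ioc (prim g u) (min x (prim g v)) := by
    ext t
    simp only [mem_inter_iff, mem_Iic, mem_Ioc, le_min_iff]
    tauto
  rw [hset, hset2, densMeas_Ioc h0 hi hur, hr, Real.volume_Ioc]

lemma lintegral_comp_prim (hm : Measurable g) (h0 : ∀ t, 0 ≤ g t) (hi : Integrable g) {u v : ℝ}
    (huv : u ≤ v) {F : ℝ → ℝ≥0∞} (hF : Measurable F) :
    ∫⁻ t in Ioc u v, ENNReal.ofReal (g t) * F (prim g t)
      = ∫⁻ s in Ioc (prim g u) (prim g v), F s := by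
  rw [← map_prim_densMeas h0 hi huv, lintegral_map hF (continuous_prim hi).measurable,
    densMeas, restrict_withDensity measurableSet_Ioc]
  exact (lintegral_withDensity_eq_lintegral_mul _ hm.ennreal_ofReal
    (hF.comp (continuous_prim hi).measurable)).symm

lemma integrableOn_comp_prim (hm : Measurable g) (h0 : ∀ t, 0 ≤ g t) (hi : Integrable g) {u v : ℝ}
    (huv : u ≤ v) {f : ℝ → ℝ} (hf : IntegrableOn f (Ioc (prim g u) (prim g v))) :
    IntegrableOn (fun t => g t * f (prim g t)) (Ioc u v) := by
  rw [IntegrableOn, ← map_prim_densMeas h0 hi huv, densMeas,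
    restrict_withDensity measurableSet_Ioc] at hf
  have h := hf.comp_measurable (continuous_prim hi).measurable
  rw [integrable_withDensity_iff hm.ennreal_ofReal (by simp)] at h
  refine h.congr (Eventually.of_forall fun t => ?_)
  simp [ENNReal.toReal_ofReal (h0 t), mul_comm]

lemma integral_comp_prim (hm : Measurable g) (h0 : ∀ t, 0 ≤ g t) (hi : Integrable g) {u v : ℝ}
    (huv : u ≤ v) {f : ℝ → ℝ} (hf : Measurable f) :
    ∫ t in u..v, g t * f (prim g t) = ∫ s in prim g u..prim g v, f s := by
  rw [intervalIntegral.integral_of_le huv,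
    intervalIntegral.integral_of_le (monotone_prim h0 hi huv), ← map_prim_densMeas h0 hi huv,
    integral_map (continuous_prim hi).measurable.aemeasurable hf.aestronglyMeasurable,
    densMeas, restrict_withDensity measurableSet_Ioc,
    integral_withDensity_eq_integral_toReal_smul hm.ennreal_ofReal (by simp)]
  refine integral_congr_ae (Eventually.of_forall fun t => ?_)
  simp [ENNReal.toReal_ofReal (h0 t)]

/-- The primitive may collapse a set of positive measure to a null set, but almost everywhere on
such a set `g` vanishes. Excluding `g t = 0` costs nothing later, since the factor `√(g t)` is zero
there. -/
lemma ae_comp_prim (hm : Measurable g) (h0 : ∀ t, 0 ≤ g t) (hi : Integrable g) {u v : ℝ}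
    (huv : u ≤ v) {p : ℝ → Prop} (hp : ∀ᵐ s ∂volume.restrict (Ioc (prim g u) (prim g v)), p s) :
    ∀ᵐ t ∂volume.restrict (Ioc u v), g t ≠ 0 → p (prim g t) := by
  rw [← map_prim_densMeas h0 hi huv, densMeas, restrict_withDensity measurableSet_Ioc] at hp
  have h := ae_of_ae_map (continuous_prim hi).measurable.aemeasurable hp
  rw [ae_withDensity_iff hm.ennreal_ofReal] at h
  filter_upwards [h] with t ht h1
  exact ht (by simpa using lt_of_le_of_ne (h0 t) h1.symm)

end Primitive

/-! ### Probability densities on the unit interval -/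

namespace IsDensity

variable {g : ℝ → ℝ} (hg : IsDensity g)
include hg

lemma integrable : Integrable g := by
  refine ⟨hg.measurable.aestronglyMeasurable, ?_⟩
  rw [hasFiniteIntegral_iff_ofReal (Eventually.of_forall hg.nonneg), hg.lintegral_eq]
  simp

lemma prim_one : prim g 1 = 1 := by
  have h1 : ∫ t, g t = 1 := by
    rw [integral_eq_lintegral_of_nonneg_ae (Eventually.of_forall hg.nonneg)
      hg.measurable.aestronglyMeasurable, hg.lintegral_eq]
    simp
  rw [prim, intervalIntegral.integral_of_le zero_le_one, ← integral_Icc_eq_integral_Ioc,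
    setIntegral_eq_integral_of_forall_compl_eq_zero hg.support, h1]

lemma monotone : Monotone (prim g) := monotone_prim hg.nonneg hg.integrable

lemma continuous : Continuous (prim g) := continuous_prim hg.integrable

lemma prim_mem {t : ℝ} (ht : t ∈ Icc (0 : ℝ) 1) : prim g t ∈ Icc (0 : ℝ) 1 :=
  ⟨prim_zero (g := g) ▸ hg.monotone ht.1, hg.prim_one ▸ hg.monotone ht.2⟩

end IsDensity

/-- A density may be given by a function that integrates to one on `[0,1]`. -/
lemma isDensity_indicator {f : ℝ → ℝ} (hf : Measurable f) (h0 : ∀ t, 0 ≤ f t)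
    (h1 : ∫⁻ t in Icc (0 : ℝ) 1, ENNReal.ofReal (f t) = 1) :
    IsDensity ((Icc (0 : ℝ) 1).indicator f) where
  measurable := hf.indicator measurableSet_Icc
  nonneg := fun t => indicator_nonneg (fun t _ => h0 t) t
  support := fun t ht => indicator_of_notMem ht f
  lintegral_eq := by
    rw [← h1, ← lintegral_indicator measurableSet_Icc]
    congr 1
    ext t
    by_cases ht : t ∈ Icc (0 : ℝ) 1 <;> simp [ht]

lemma isDensity_indicator_of_integral {f : ℝ → ℝ} (hf : Measurable f) (h0 : ∀ t, 0 ≤ f t)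
    (hi : IntegrableOn f (Icc 0 1)) (h1 : ∫ t in (0 : ℝ)..1, f t = 1) :
    IsDensity ((Icc (0 : ℝ) 1).indicator f) := by
  refine isDensity_indicator hf h0 ?_
  rw [← ofReal_integral_eq_lintegral_ofReal hi (Eventually.of_forall h0),
    integral_Icc_eq_integral_Ioc, ← intervalIntegral.integral_of_le zero_le_one, h1]
  simp

lemma prim_indicator {f : ℝ → ℝ} {t : ℝ} (ht : t ∈ Icc (0 : ℝ) 1) :
    prim ((Icc (0 : ℝ) 1).indicator f) t = prim f t := by
  refine intervalIntegral.integral_congr fun s hs => ?_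
  rw [uIcc_of_le ht.1] at hs
  have h : s ∈ Icc (0 : ℝ) 1 := ⟨hs.1, hs.2.trans ht.2⟩
  simp only [Set.indicator_of_mem h]

/-- Lebesgue measure on `[0,1]`. -/
noncomputable abbrev volI : Measure ℝ := volume.restrict (Icc (0 : ℝ) 1)

lemma volI_eq : volI = volume.restrict (Ioc (0 : ℝ) 1) :=
  Measure.restrict_congr_set Ioc_ae_eq_Icc.symm

lemma IsDensity.ae_comp {g : ℝ → ℝ} (hg : IsDensity g) {p : ℝ → Prop} (hp : ∀ᵐ s ∂volI, p s) :
    ∀ᵐ t ∂volI, g t ≠ 0 → p (prim g t) := by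
  rw [volI_eq] at hp ⊢
  refine ae_comp_prim hg.measurable hg.nonneg hg.integrable zero_le_one ?_
  rwa [prim_zero, hg.prim_one]

lemma IsDensity.lintegral_comp {g : ℝ → ℝ} (hg : IsDensity g) {F : ℝ → ℝ≥0∞} (hF : Measurable F) :
    ∫⁻ t, ENNReal.ofReal (g t) * F (prim g t) ∂volI = ∫⁻ s, F s ∂volI := by
  rw [volI_eq, lintegral_comp_prim hg.measurable hg.nonneg hg.integrable zero_le_one hF,
    prim_zero, hg.prim_one]

/-- Change of variables for the indicator of `sᶜ` expresses the measure of `sᶜ` as an integral whose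
integrand vanishes almost everywhere. -/
lemma IsDensity.ae_of_ae_comp {g : ℝ → ℝ} (hg : IsDensity g) {s : Set ℝ} (hs : MeasurableSet s)
    (h : ∀ᵐ t ∂volI, g t ≠ 0 → prim g t ∈ s) : ∀ᵐ t ∂volI, t ∈ s := by
  have h1 := hg.lintegral_comp (measurable_one.indicator hs.compl : Measurable (sᶜ.indicator 1))
  rw [lintegral_indicator_one hs.compl] at h1
  rw [ae_iff, show {t | ¬t ∈ s} = sᶜ from rfl, ← h1]
  refine (lintegral_eq_zero_iff (hg.measurable.ennreal_ofReal.mul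
    ((measurable_one.indicator hs.compl).comp hg.continuous.measurable))).2 ?_
  filter_upwards [h] with t ht
  by_cases h0 : g t = 0
  · simp [h0]
  · simp [ht h0]

/-! ### The isometries of `L²` induced by densities -/

variable {N : ℕ}

/-- The function `t ↦ √g(t) • q(∫₀ᵗ g)`. -/
noncomputable def reparamFun (g : ℝ → ℝ) (q : ℝ → EuclideanSpace ℝ (Fin N)) (t : ℝ) :
    EuclideanSpace ℝ (Fin N) :=
  Real.sqrt (g t) • q (prim g t)

lemma reparamFun_congr {g : ℝ → ℝ} (hg : IsDensity g) {q q' : ℝ → EuclideanSpace ℝ (Fin N)}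
    (h : q =ᵐ[volI] q') : reparamFun g q =ᵐ[volI] reparamFun g q' := by
  filter_upwards [hg.ae_comp h] with t ht
  by_cases h0 : g t = 0
  · simp [reparamFun, h0]
  · simp [reparamFun, ht h0]

lemma lintegral_reparamFun {g : ℝ → ℝ} (hg : IsDensity g) {q : ℝ → EuclideanSpace ℝ (Fin N)}
    (hq : Measurable q) :
    ∫⁻ t, ‖reparamFun g q t‖ₑ ^ (2 : ℝ) ∂volI = ∫⁻ t, ‖q t‖ₑ ^ (2 : ℝ) ∂volI := by
  rw [← hg.lintegral_comp (hq.enorm.pow_const _)]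
  congr 1
  ext t
  rw [reparamFun, enorm_smul, ENNReal.mul_rpow_of_nonneg _ _ zero_le_two,
    Real.enorm_of_nonneg (Real.sqrt_nonneg _), ENNReal.ofReal_rpow_of_nonneg (Real.sqrt_nonneg _)
    zero_le_two, Real.rpow_two, Real.sq_sqrt (hg.nonneg t)]

lemma eLpNorm_reparamFun {g : ℝ → ℝ} (hg : IsDensity g) {q : ℝ → EuclideanSpace ℝ (Fin N)}
    (hq : Measurable q) : eLpNorm (reparamFun g q) 2 volI = eLpNorm q 2 volI := by
  rw [eLpNorm_eq_lintegral_rpow_enorm_toReal two_ne_zero ENNReal.ofNat_ne_top,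
    eLpNorm_eq_lintegral_rpow_enorm_toReal two_ne_zero ENNReal.ofNat_ne_top]
  simp only [ENNReal.toReal_ofNat]
  rw [lintegral_reparamFun hg hq]

lemma measurable_reparamFun {g : ℝ → ℝ} (hg : IsDensity g) {q : ℝ → EuclideanSpace ℝ (Fin N)}
    (hq : Measurable q) : Measurable (reparamFun g q) :=
  hg.measurable.sqrt.smul (hq.comp hg.continuous.measurable)

lemma measurable_coe (q : L2 N) : Measurable q := (Lp.stronglyMeasurable q).measurable

lemma memLp_reparamFun {g : ℝ → ℝ} (hg : IsDensity g) (q : L2 N) :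
    MemLp (reparamFun g q) 2 volI := by
  refine ⟨(measurable_reparamFun hg (measurable_coe q)).aestronglyMeasurable, ?_⟩
  rw [eLpNorm_reparamFun hg (measurable_coe q)]
  exact Lp.eLpNorm_lt_top q

/-- The isometry of `L²(I, ℝᴺ)` given by a weakly increasing reparametrization with density `g`. -/
noncomputable def reparam {g : ℝ → ℝ} (hg : IsDensity g) : L2 N →ₗᵢ[ℝ] L2 N where
  toFun q := (memLp_reparamFun hg q).toLp _
  map_add' p q := by
    rw [← MemLp.toLp_add]
    refine MemLp.toLp_congr _ _ ?_
    filter_upwards [reparamFun_congr hg (Lp.coeFn_add p q)] with t ht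
    rw [ht]
    exact smul_add _ _ _
  map_smul' c q := by
    rw [RingHom.id_apply, ← MemLp.toLp_const_smul]
    refine MemLp.toLp_congr _ _ ?_
    filter_upwards [reparamFun_congr hg (Lp.coeFn_smul c q)] with t ht
    rw [ht]
    exact smul_comm (√(g t)) c (q (prim g t))
  norm_map' q := by
    simp only [LinearMap.coe_mk, AddHom.coe_mk, Lp.norm_toLp]
    rw [eLpNorm_reparamFun hg (measurable_coe q), Lp.norm_def]

lemma coeFn_reparam {g : ℝ → ℝ} (hg : IsDensity g) (q : L2 N) :
    reparam hg q =ᵐ[volI] reparamFun g q := (memLp_reparamFun hg q).coeFn_toLp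

/-! ### Composition and inverses -/

/-- The density of the composition of the reparametrizations with densities `g` and `h`. -/
noncomputable def compDens (g h : ℝ → ℝ) (t : ℝ) : ℝ := h t * g (prim h t)

lemma isDensity_compDens {g h : ℝ → ℝ} (hg : IsDensity g) (hh : IsDensity h) :
    IsDensity (compDens g h) where
  measurable := hh.measurable.mul (hg.measurable.comp hh.continuous.measurable)
  nonneg t := mul_nonneg (hh.nonneg t) (hg.nonneg _)
  support t ht := by simp [compDens, hh.support t ht]
  lintegral_eq := by
    have h1 := hh.lintegral_comp hg.measurable.ennreal_ofReal
    have h2 : ∫⁻ s, ENNReal.ofReal (g s) ∂volI = 1 := by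
      rw [← hg.lintegral_eq, setLIntegral_eq_of_support_subset]
      intro t ht
      by_contra h0
      simp [hg.support t h0] at ht
    rw [← h2, ← h1, setLIntegral_eq_of_support_subset]
    · simp only [compDens, ENNReal.ofReal_mul (hh.nonneg _)]
    · intro t ht
      by_contra h0
      simp [hh.support t h0] at ht

lemma prim_compDens {g h : ℝ → ℝ} (hg : IsDensity g) (hh : IsDensity h) {t : ℝ} (ht : 0 ≤ t) :
    prim (compDens g h) t = prim g (prim h t) := by
  have := integral_comp_prim hh.measurable hh.nonneg hh.integrable ht hg.measurable
  rw [prim_zero] at this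
  exact this

lemma reparam_reparam {g h : ℝ → ℝ} (hg : IsDensity g) (hh : IsDensity h) (q : L2 N) :
    reparam hh (reparam hg q) = reparam (isDensity_compDens hg hh) q := by
  apply Lp.ext
  filter_upwards [coeFn_reparam hh (reparam hg q), coeFn_reparam (isDensity_compDens hg hh) q,
    reparamFun_congr hh (coeFn_reparam hg q), ae_restrict_mem measurableSet_Icc] with t h1 h2 h3 ht
  rw [h1, h2, h3, reparamFun, reparamFun, reparamFun, prim_compDens hg hh ht.1, smul_smul,
    compDens, Real.sqrt_mul (hh.nonneg t)]

/-- The inverse of the reparametrization with density `g`. -/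
noncomputable def invPrim (g : ℝ → ℝ) (s : ℝ) : ℝ := sSup {t ∈ Icc (0 : ℝ) 1 | prim g t ≤ s}

lemma monotone_invPrim (g : ℝ → ℝ) : Monotone (invPrim g) := by
  intro s s' h
  -- On the empty set `sSup` is `0`, a lower bound for all values of `invPrim`, so monotonicity, and
  -- with it measurability, holds on all of `ℝ`.
  rcases Set.eq_empty_or_nonempty {t ∈ Icc (0 : ℝ) 1 | prim g t ≤ s} with h0 | h0
  · rw [invPrim, h0, Real.sSup_empty]
    exact Real.sSup_nonneg fun t ht => ht.1.1
  · exact csSup_le_csSup ⟨1, fun t ht => ht.1.2⟩ h0 fun t ht => ⟨ht.1, ht.2.trans h⟩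

/-- Densities of strictly increasing reparametrizations. -/
structure IsPosDensity (g : ℝ → ℝ) : Prop extends IsDensity g where
  pos : ∀ᵐ t ∂volI, 0 < g t

lemma IsPosDensity.prim_lt {g : ℝ → ℝ} (hg : IsPosDensity g) {u v : ℝ} (hu : 0 ≤ u) (huv : u < v)
    (hv : v ≤ 1) : prim g u < prim g v := by
  have h := prim_sub hg.integrable u v
  have h2 : 0 < ∫ s in u..v, g s := by
    rw [intervalIntegral.integral_pos_iff_support_of_nonneg_ae (Eventually.of_forall hg.nonneg)
      hg.integrable.intervalIntegrable]
    refine ⟨huv, ?_⟩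
    have hsub : Ioc u v ≤ᵐ[volume] (Function.support g ∩ Ioc u v : Set ℝ) := by
      have hp := hg.pos
      rw [ae_restrict_iff' measurableSet_Icc] at hp
      filter_upwards [hp] with t ht hm
      exact ⟨(ht ⟨hu.trans hm.1.le, hm.2.trans hv⟩).ne', hm⟩
    refine lt_of_lt_of_le ?_ (measure_mono_ae hsub)
    simpa using huv
  linarith

lemma invPrim_prim {g : ℝ → ℝ} (hg : IsPosDensity g) {t : ℝ} (ht : t ∈ Icc (0 : ℝ) 1) :
    invPrim g (prim g t) = t := by
  have : {t' ∈ Icc (0 : ℝ) 1 | prim g t' ≤ prim g t} = Icc 0 t := by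
    ext t'
    constructor
    · rintro ⟨h1, h2⟩
      refine ⟨h1.1, ?_⟩
      by_contra! h
      exact absurd (hg.prim_lt ht.1 h h1.2) (not_lt.2 h2)
    · rintro ⟨h1, h2⟩
      exact ⟨⟨h1, h2.trans ht.2⟩, hg.monotone h2⟩
  rw [invPrim, this, csSup_Icc ht.1]

/-- The density of the inverse of the reparametrization with density `g`. -/
noncomputable def invDens (g : ℝ → ℝ) : ℝ → ℝ :=
  (Icc (0 : ℝ) 1).indicator fun s => (g (invPrim g s))⁻¹

lemma invDens_prim {g : ℝ → ℝ} (hg : IsPosDensity g) {t : ℝ} (ht : t ∈ Icc (0 : ℝ) 1) :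
    invDens g (prim g t) = (g t)⁻¹ := by
  rw [invDens, Set.indicator_of_mem (hg.prim_mem ht), invPrim_prim hg ht]

/-- Substituting `s = prim g t` turns the total mass into the integral of `g t * (g t)⁻¹`, which is
`1` since `g` is positive almost everywhere. -/
lemma isPosDensity_invDens {g : ℝ → ℝ} (hg : IsPosDensity g) : IsPosDensity (invDens g) := by
  have hm : Measurable fun s => (g (invPrim g s))⁻¹ :=
    (hg.measurable.comp (monotone_invPrim g).measurable).inv
  refine ⟨isDensity_indicator hm (fun _ => inv_nonneg.2 (hg.nonneg _)) ?_, ?_⟩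
  · rw [← hg.lintegral_comp hm.ennreal_ofReal]
    have : ∫⁻ _ : ℝ, (1 : ℝ≥0∞) ∂volI = 1 := by simp
    rw [← this]
    refine lintegral_congr_ae ?_
    filter_upwards [hg.pos, ae_restrict_mem measurableSet_Icc] with t h0 ht
    rw [invPrim_prim hg ht, ← ENNReal.ofReal_mul (hg.nonneg t), mul_inv_cancel₀ h0.ne']
    simp
  · refine hg.ae_of_ae_comp (measurableSet_lt measurable_const
      (hm.indicator measurableSet_Icc)) ?_
    filter_upwards [hg.pos, ae_restrict_mem measurableSet_Icc] with t h0 ht _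
    have h := invDens_prim hg ht
    change 0 < invDens g (prim g t)
    rw [h]
    exact inv_pos.2 h0

lemma compDens_invDens {g : ℝ → ℝ} (hg : IsPosDensity g) :
    ∀ᵐ t ∂volI, compDens (invDens g) g t = 1 := by
  filter_upwards [hg.pos, ae_restrict_mem measurableSet_Icc] with t h0 ht
  rw [compDens, invDens_prim hg ht, mul_inv_cancel₀ h0.ne']

lemma reparam_invDens {g : ℝ → ℝ} (hg : IsPosDensity g) (q : L2 N) :
    reparam hg.toIsDensity (reparam (isPosDensity_invDens hg).toIsDensity q) = q := by
  rw [reparam_reparam]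
  apply Lp.ext
  have hc := compDens_invDens hg
  filter_upwards [coeFn_reparam (isDensity_compDens (isPosDensity_invDens hg).toIsDensity
    hg.toIsDensity) q, hc, ae_restrict_mem measurableSet_Icc] with t h1 h2 ht
  have h3 : prim (compDens (invDens g) g) t = t := by
    have : prim (compDens (invDens g) g) t = ∫ s in (0 : ℝ)..t, (1 : ℝ) := by
      refine intervalIntegral.integral_congr_ae ?_
      rw [ae_restrict_iff' measurableSet_Icc] at hc
      filter_upwards [hc] with s hs hs'
      rw [uIoc_of_le ht.1] at hs'
      exact hs ⟨hs'.1.le, hs'.2.trans ht.2⟩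
    simpa using this
  rw [h1, reparamFun, h2, h3]
  simp

/-- A right inverse of an injective map is also a left inverse, so the other composition of
densities need not be computed. -/
lemma reparam_invDens' {g : ℝ → ℝ} (hg : IsPosDensity g) (q : L2 N) :
    reparam (isPosDensity_invDens hg).toIsDensity (reparam hg.toIsDensity q) = q :=
  (reparam hg.toIsDensity).injective (reparam_invDens hg _)

/-! ### Orbits in terms of densities -/

lemma IsReparam.exists_density {γ : ℝ → ℝ} (hγ : IsReparam γ) :
    ∃ g, IsPosDensity g ∧ (∀ t ∈ Icc (0 : ℝ) 1, prim g t = γ t) ∧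
      ∀ᵐ t ∂volI, g t = deriv γ t := by
  -- The derivative is positive only almost everywhere, whereas a density is nonnegative at every
  -- point.
  set f : ℝ → ℝ := fun t => max (deriv γ t) 0
  have hfm : Measurable f := (measurable_deriv γ).max measurable_const
  have hfae : ∀ᵐ t ∂volI, f t = deriv γ t := by
    filter_upwards [hγ.deriv_pos] with t ht
    exact max_eq_left ht.le
  have hfae' : ∀ᵐ t, t ∈ Icc (0 : ℝ) 1 → f t = deriv γ t := by
    rwa [← ae_restrict_iff' measurableSet_Icc]
  have hi : IntegrableOn f (Icc 0 1) := by
    have h := hγ.absCont.intervalIntegrable_deriv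
    rw [intervalIntegrable_iff_integrableOn_Icc_of_le zero_le_one] at h
    exact h.congr (hfae.mono fun t ht => ht.symm)
  have hprim : ∀ t ∈ Icc (0 : ℝ) 1, prim f t = γ t := by
    intro t ht
    have hac : AbsolutelyContinuousOnInterval γ 0 t := by
      refine hγ.absCont.mono ?_
      rw [uIcc_of_le ht.1, uIcc_of_le zero_le_one]
      exact Icc_subset_Icc_right ht.2
    have h := hac.integral_deriv_eq_sub
    rw [hγ.map_zero, sub_zero] at h
    rw [← h]
    refine intervalIntegral.integral_congr_ae ?_
    filter_upwards [hfae'] with s hs hs'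
    rw [uIoc_of_le ht.1] at hs'
    exact hs ⟨hs'.1.le, hs'.2.trans ht.2⟩
  have hd : IsDensity ((Icc (0 : ℝ) 1).indicator f) :=
    isDensity_indicator_of_integral hfm (fun t => le_max_right _ _) hi
      ((hprim 1 (by simp)).trans hγ.map_one)
  refine ⟨_, ⟨hd, ?_⟩, fun t ht => (prim_indicator ht).trans (hprim t ht), ?_⟩
  · filter_upwards [hfae, hγ.deriv_pos, ae_restrict_mem measurableSet_Icc] with t h1 h2 ht
    rwa [Set.indicator_of_mem ht, h1]
  · filter_upwards [hfae, ae_restrict_mem measurableSet_Icc] with t h1 ht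
    rwa [Set.indicator_of_mem ht]

lemma IsDensity.deriv_prim {g : ℝ → ℝ} (hg : IsDensity g) : ∀ᵐ t, deriv (prim g) t = g t := by
  filter_upwards [LocallyIntegrable.ae_hasDerivAt_integral hg.integrable.locallyIntegrable] with t ht
  exact (ht 0).deriv

lemma IsPosDensity.isReparam {g : ℝ → ℝ} (hg : IsPosDensity g) : IsReparam (prim g) where
  mapsTo _ ht := hg.prim_mem ht
  absCont := hg.integrable.intervalIntegrable.absolutelyContinuousOnInterval_intervalIntegral
    (by simp)
  map_zero := prim_zero
  map_one := hg.prim_one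
  deriv_pos := by
    filter_upwards [hg.pos, ae_restrict_of_ae hg.deriv_prim] with t h1 h2
    rwa [h2]

/-- The dictionary between `Γ` and positive densities: an absolutely continuous function is the
primitive of its derivative, and a primitive has its density as derivative almost everywhere. -/
lemma mem_orbit_iff {p q : L2 N} :
    p ∈ orbit q ↔ ∃ g, ∃ hg : IsPosDensity g, p = reparam hg.toIsDensity q := by
  constructor
  · rintro ⟨γ, hγ, hp⟩
    obtain ⟨g, hg, h1, h2⟩ := hγ.exists_density
    refine ⟨g, hg, Lp.ext ?_⟩
    filter_upwards [hp, coeFn_reparam hg.toIsDensity q, h2, ae_restrict_mem measurableSet_Icc]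
      with t h3 h4 h5 ht
    rw [h3, h4, act, reparamFun, h5, h1 t ht]
  · rintro ⟨g, hg, rfl⟩
    refine ⟨prim g, hg.isReparam, ?_⟩
    filter_upwards [coeFn_reparam hg.toIsDensity q, ae_restrict_of_ae hg.deriv_prim] with t h1 h2
    rw [h1, act, h2, reparamFun]

/-! ### Weakly increasing reparametrizations do not leave the closure of the orbit -/

/-- A convex combination of a density and the uniform density on `[0,1]`. -/
noncomputable def mixDens (g : ℝ → ℝ) (ε : ℝ) : ℝ → ℝ :=
  (Icc (0 : ℝ) 1).indicator fun t => (1 - ε) * g t + ε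

lemma prim_mixDens {g : ℝ → ℝ} (hg : IsDensity g) (ε : ℝ) {t : ℝ} (ht : t ∈ Icc (0 : ℝ) 1) :
    prim (mixDens g ε) t = (1 - ε) * prim g t + ε * t := by
  rw [mixDens, prim_indicator ht, prim, intervalIntegral.integral_add
    (hg.integrable.intervalIntegrable.const_mul _) intervalIntegrable_const,
    intervalIntegral.integral_const_mul, intervalIntegral.integral_const]
  simp [prim, mul_comm]

lemma isPosDensity_mixDens {g : ℝ → ℝ} (hg : IsDensity g) {ε : ℝ} (h0 : 0 < ε) (h1 : ε ≤ 1) :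
    IsPosDensity (mixDens g ε) := by
  have hpos : ∀ t, 0 < (1 - ε) * g t + ε := fun t =>
    add_pos_of_nonneg_of_pos (mul_nonneg (sub_nonneg.2 h1) (hg.nonneg t)) h0
  refine ⟨isDensity_indicator_of_integral ((hg.measurable.const_mul _).add_const _)
    (fun t => (hpos t).le) ((hg.integrable.integrableOn.const_mul _).add (by simp)) ?_, ?_⟩
  · have h := prim_mixDens hg ε (t := 1) (by simp)
    rw [mixDens, prim_indicator (by simp), hg.prim_one] at h
    exact h.trans (by ring)
  · filter_upwards [ae_restrict_mem measurableSet_Icc] with t ht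
    rw [mixDens, Set.indicator_of_mem ht]
    exact hpos t

lemma norm_sq_eq_integral (q : L2 N) : ‖q‖ ^ 2 = ∫ t, ‖q t‖ ^ 2 ∂volI := by
  rw [← real_inner_self_eq_norm_sq, L2.inner_def]
  simp only [real_inner_self_eq_norm_sq]

lemma tendsto_reparam_of_continuous {ι : Type*} {l : Filter ι} [l.IsCountablyGenerated]
    {g : ℝ → ℝ} (hg : IsDensity g) {G : ι → ℝ → ℝ} (hG : ∀ i, IsDensity (G i))
    (hle : ∀ i, ∀ t ∈ Icc (0 : ℝ) 1, G i t ≤ g t + 1)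
    (hlim : ∀ t ∈ Icc (0 : ℝ) 1, Tendsto (fun i => G i t) l (𝓝 (g t)))
    (hlim' : ∀ t ∈ Icc (0 : ℝ) 1, Tendsto (fun i => prim (G i) t) l (𝓝 (prim g t)))
    {q : L2 N} {v : ℝ → EuclideanSpace ℝ (Fin N)} (hv : Continuous v) {M : ℝ}
    (hM : ∀ t, ‖v t‖ ≤ M) (hq : q =ᵐ[volI] v) :
    Tendsto (fun i => reparam (hG i) q) l (𝓝 (reparam hg q)) := by
  have hM0 : 0 ≤ M := (norm_nonneg _).trans (hM 0)
  have hae : ∀ i, (fun t => ‖(reparam (hG i) q - reparam hg q : L2 N) t‖ ^ 2) =ᵐ[volI]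
      fun t => ‖reparamFun (G i) v t - reparamFun g v t‖ ^ 2 := by
    intro i
    filter_upwards [Lp.coeFn_sub (reparam (hG i) q) (reparam hg q), coeFn_reparam (hG i) q,
      coeFn_reparam hg q, reparamFun_congr (hG i) hq, reparamFun_congr hg hq] with t h1 h2 h3 h4 h5
    rw [h1, Pi.sub_apply, h2, h3, h4, h5]
  have key : Tendsto (fun i => ∫ t, ‖reparamFun (G i) v t - reparamFun g v t‖ ^ 2 ∂volI) l
      (𝓝 (∫ _, 0 ∂volI)) := by
    refine tendsto_integral_filter_of_dominated_convergence
      -- This bound comes from `(a + b)² ≤ 2 (a² + b²)`, `‖√(h t) • v‖² ≤ h t * M²` and `G i ≤ g +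
      -- 1`.
      (fun t => 2 * M ^ 2 * (2 * g t + 1)) ?_ ?_ ?_ ?_
    · exact Eventually.of_forall fun i => (((measurable_reparamFun (hG i) hv.measurable).sub
        (measurable_reparamFun hg hv.measurable)).norm.pow_const 2).aestronglyMeasurable
    · refine Eventually.of_forall fun i => ?_
      filter_upwards [ae_restrict_mem measurableSet_Icc] with t ht
      have hb : ∀ {h : ℝ → ℝ}, IsDensity h → ‖reparamFun h v t‖ ^ 2 ≤ h t * M ^ 2 := by
        intro h hh
        rw [reparamFun, norm_smul, mul_pow, Real.norm_eq_abs, sq_abs, Real.sq_sqrt (hh.nonneg t)]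
        exact mul_le_mul_of_nonneg_left (pow_le_pow_left₀ (norm_nonneg _) (hM _) 2) (hh.nonneg t)
      have h1 := hb (hG i)
      have h2 := hb hg
      have h3 := norm_sub_le (reparamFun (G i) v t) (reparamFun g v t)
      have h4 := hle i t ht
      rw [Real.norm_eq_abs, abs_of_nonneg (by positivity)]
      calc ‖reparamFun (G i) v t - reparamFun g v t‖ ^ 2
          ≤ (‖reparamFun (G i) v t‖ + ‖reparamFun g v t‖) ^ 2 :=
            pow_le_pow_left₀ (norm_nonneg _) h3 2
        _ ≤ 2 * (‖reparamFun (G i) v t‖ ^ 2 + ‖reparamFun g v t‖ ^ 2) := add_sq_le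
        _ ≤ 2 * (G i t * M ^ 2 + g t * M ^ 2) := by gcongr
        _ ≤ 2 * ((g t + 1) * M ^ 2 + g t * M ^ 2) := by gcongr
        _ = 2 * M ^ 2 * (2 * g t + 1) := by ring
    · exact ((hg.integrable.integrableOn.const_mul 2).add (by simp)).const_mul _
    · filter_upwards [ae_restrict_mem measurableSet_Icc] with t ht
      have h1 : Tendsto (fun i => reparamFun (G i) v t) l (𝓝 (reparamFun g v t)) :=
        ((Real.continuous_sqrt.tendsto _).comp (hlim t ht)).smul
          ((hv.tendsto _).comp (hlim' t ht))
      have h2 := ((h1.sub_const (reparamFun g v t)).norm).pow 2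
      simpa using h2
  rw [tendsto_iff_norm_sub_tendsto_zero]
  have h2 : Tendsto (fun i => ‖reparam (hG i) q - reparam hg q‖ ^ 2) l (𝓝 0) := by
    simp only [norm_sq_eq_integral, integral_congr_ae (hae _)]
    simpa using key
  have h3 := (Real.continuous_sqrt.tendsto 0).comp h2
  simpa [Function.comp_def, Real.sqrt_sq (norm_nonneg _)] using h3

/-- Bounded continuous functions are dense in `L²`, and all the operators are isometries, so an
`ε/3` argument extends the convergence to every `q`. -/
lemma tendsto_reparam {ι : Type*} {l : Filter ι} [l.IsCountablyGenerated]
    {g : ℝ → ℝ} (hg : IsDensity g) {G : ι → ℝ → ℝ} (hG : ∀ i, IsDensity (G i))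
    (hle : ∀ i, ∀ t ∈ Icc (0 : ℝ) 1, G i t ≤ g t + 1)
    (hlim : ∀ t ∈ Icc (0 : ℝ) 1, Tendsto (fun i => G i t) l (𝓝 (g t)))
    (hlim' : ∀ t ∈ Icc (0 : ℝ) 1, Tendsto (fun i => prim (G i) t) l (𝓝 (prim g t))) (q : L2 N) :
    Tendsto (fun i => reparam (hG i) q) l (𝓝 (reparam hg q)) := by
  rw [Metric.tendsto_nhds]
  intro ε hε
  obtain ⟨f, hf, hqf⟩ := Metric.mem_closure_iff.1
    (Lp.boundedContinuousFunction_dense (EuclideanSpace ℝ (Fin N)) volI ENNReal.ofNat_ne_top q)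
    (ε / 3) (by positivity)
  obtain ⟨v, hv⟩ := Lp.mem_boundedContinuousFunction_iff.1 hf
  have hfv : f =ᵐ[volI] v := by
    have h := ContinuousMap.coeFn_toAEEqFun volI v.toContinuousMap
    rwa [hv] at h
  have hlimf := tendsto_reparam_of_continuous hg hG hle hlim hlim' v.continuous
    (fun t => v.norm_coe_le_norm t) hfv
  filter_upwards [Metric.tendsto_nhds.1 hlimf (ε / 3) (by positivity)] with i hi
  calc dist (reparam (hG i) q) (reparam hg q)
      ≤ dist (reparam (hG i) q) (reparam (hG i) f) + dist (reparam (hG i) f) (reparam hg f)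
        + dist (reparam hg f) (reparam hg q) := dist_triangle4 _ _ _ _
    _ < ε / 3 + ε / 3 + ε / 3 := by
        rw [(reparam (hG i)).dist_map, (reparam hg).dist_map, dist_comm f q]
        gcongr
    _ = ε := by ring

lemma exists_tendsto_reparam {g : ℝ → ℝ} (hg : IsDensity g) (q : L2 N) :
    ∃ (G : ℕ → ℝ → ℝ) (hG : ∀ n, IsPosDensity (G n)),
      Tendsto (fun n => reparam (hG n).toIsDensity q) atTop (𝓝 (reparam hg q)) := by
  have he := tendsto_one_div_add_atTop_nhds_zero_nat (𝕜 := ℝ)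
  have h0 : ∀ n : ℕ, (0 : ℝ) < 1 / ((n : ℝ) + 1) := fun n => by positivity
  have h1 : ∀ n : ℕ, 1 / ((n : ℝ) + 1) ≤ 1 := fun n => by
    rw [div_le_one (by positivity)]
    have : (0 : ℝ) ≤ n := by positivity
    linarith
  refine ⟨fun n => mixDens g (1 / ((n : ℝ) + 1)), fun n => isPosDensity_mixDens hg (h0 n) (h1 n),
    tendsto_reparam hg _ ?_ ?_ ?_ q⟩
  · intro n t ht
    rw [mixDens, Set.indicator_of_mem ht]
    nlinarith [h0 n, h1 n, hg.nonneg t]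
  · intro t ht
    simp only [mixDens, Set.indicator_of_mem ht]
    simpa using ((he.const_sub 1).mul_const (g t)).add he
  · intro t ht
    simp only [prim_mixDens hg _ ht]
    simpa using ((he.const_sub 1).mul_const (prim g t)).add (he.mul_const t)

lemma reparam_mem_closure_orbit {g : ℝ → ℝ} (hg : IsDensity g) (q : L2 N) :
    reparam hg q ∈ closure (orbit q) := by
  obtain ⟨G, hG, h⟩ := exists_tendsto_reparam hg q
  exact mem_closure_of_tendsto h
    (Eventually.of_forall fun n => mem_orbit_iff.2 ⟨G n, hG n, rfl⟩)

/-- For the harder inclusion, approximate `reparam hg q` by `reparam` of `q` with positive densities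
`G n`. Undoing `G n` is an isometry, so `q` itself is close to a reparametrization of `reparam hg
q`; applying `h` preserves this closeness. -/
lemma closure_orbit_reparam {g : ℝ → ℝ} (hg : IsDensity g) (q : L2 N) :
    closure (orbit (reparam hg q)) = closure (orbit q) := by
  refine Subset.antisymm (closure_minimal ?_ isClosed_closure)
    (closure_minimal ?_ isClosed_closure)
  · intro p hp
    obtain ⟨h, hh, rfl⟩ := mem_orbit_iff.1 hp
    rw [reparam_reparam]
    exact reparam_mem_closure_orbit _ q
  · intro p hp
    obtain ⟨h, hh, rfl⟩ := mem_orbit_iff.1 hp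
    obtain ⟨G, hG, hlim⟩ := exists_tendsto_reparam hg q
    rw [Metric.mem_closure_iff]
    intro ε hε
    obtain ⟨n, hn⟩ := ((Metric.tendsto_nhds.1 hlim) ε hε).exists
    have hI := isPosDensity_invDens (hG n)
    have hmem := reparam_mem_closure_orbit (isDensity_compDens hI.toIsDensity hh.toIsDensity)
      (reparam hg q)
    rw [← reparam_reparam hI.toIsDensity hh.toIsDensity] at hmem
    have hlt : dist (reparam hh.toIsDensity q)
        (reparam hh.toIsDensity (reparam hI.toIsDensity (reparam hg q))) < ε := by
      rw [(reparam hh.toIsDensity).dist_map]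
      nth_rw 1 [← reparam_invDens' (hG n) q]
      rwa [(reparam hI.toIsDensity).dist_map]
    -- The slack left in `hlt` pays for moving from the closure to the orbit itself.
    obtain ⟨b, hb, hb'⟩ := Metric.mem_closure_iff.1 hmem _ (sub_pos.2 hlt)
    have htri := dist_triangle (reparam hh.toIsDensity q)
      (reparam hh.toIsDensity (reparam hI.toIsDensity (reparam hg q))) b
    exact ⟨b, hb, by linarith⟩

lemma cls_reparam {g : ℝ → ℝ} (hg : IsDensity g) (q : L2 N) : cls (reparam hg q) = cls q :=
  Quotient.sound (closure_orbit_reparam hg q)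

lemma isPosDensity_one : IsPosDensity ((Icc (0 : ℝ) 1).indicator fun _ => 1) := by
  refine ⟨isDensity_indicator_of_integral measurable_const (by simp) (by simp) (by simp), ?_⟩
  filter_upwards [ae_restrict_mem measurableSet_Icc] with t ht
  simp [Set.indicator_of_mem ht]

/-- Writing `q` as a reparametrization of a reparametrization of `q` avoids checking that the
identity acts trivially; any positive density would serve. -/
lemma self_mem_closure_orbit (q : L2 N) : q ∈ closure (orbit q) := by
  have hg := isPosDensity_one
  have h := reparam_mem_closure_orbit hg.toIsDensity
    (reparam (isPosDensity_invDens hg).toIsDensity q)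
  rwa [reparam_invDens hg, closure_orbit_reparam] at h

lemma mem_closure_orbit_of_cls_eq {p q : L2 N} (h : cls p = cls q) : p ∈ closure (orbit q) := by
  have h1 : closure (orbit p) = closure (orbit q) := Quotient.exact h
  rw [← h1]
  exact self_mem_closure_orbit p

/-! ### Partitions of the unit interval -/

lemma sum_integral_partition {f : ℝ → ℝ} {n : ℕ} {u : Fin (n + 1) → ℝ}
    (hf : ∀ j : Fin n, IntervalIntegrable f volume (u j.castSucc) (u j.succ)) :
    ∑ j : Fin n, ∫ t in u j.castSucc..u j.succ, f t = ∫ t in u 0..u (Fin.last n), f t := by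
  induction n with
  | zero => simp
  | succ n ih =>
    have hI : ∀ k : ℕ, ∀ hk : k ≤ n + 1, IntervalIntegrable f volume (u 0) (u ⟨k, by omega⟩) := by
      intro k
      induction k with
      | zero => intro _; exact IntervalIntegrable.refl
      | succ k ihk => intro hk; exact (ihk (by omega)).trans (hf ⟨k, by omega⟩)
    rw [Fin.sum_univ_castSucc]
    have h := ih (u := fun j => u j.castSucc) fun j => hf j.castSucc
    simp only [Fin.castSucc_zero] at h
    simp only [← Fin.castSucc_succ, h]
    exact intervalIntegral.integral_add_adjacent_intervals (hI n (by omega)) (hf (Fin.last n))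

lemma exists_partition_prim_eq {g : ℝ → ℝ} (hg : IsDensity g) {n : ℕ} {t : Fin (n + 1) → ℝ}
    (ht : StrictMono t) (h0 : t 0 = 0) (h1 : t (Fin.last n) = 1) :
    ∃ u : Fin (n + 1) → ℝ, Monotone u ∧ u 0 = 0 ∧ u (Fin.last n) = 1 ∧ ∀ j, prim g (u j) = t j := by
  -- `prim g` may be flat near the ends of `[0,1]`, so the preimages of `0` and `1` have to be
  -- chosen as `0` and `1`.
  have key : ∀ j, ∃ r ∈ Icc (0 : ℝ) 1, prim g r = t j ∧ (t j = 0 → r = 0) ∧ (t j = 1 → r = 1) := by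
    intro j
    by_cases hj0 : t j = 0
    · exact ⟨0, by simp, by rw [prim_zero, hj0], fun _ => rfl, fun h => by linarith⟩
    by_cases hj1 : t j = 1
    · exact ⟨1, by simp, by rw [hg.prim_one, hj1], fun h => by linarith, fun _ => rfl⟩
    have hmem : t j ∈ Icc (prim g 0) (prim g 1) := by
      rw [prim_zero, hg.prim_one]
      exact ⟨h0 ▸ ht.monotone (Fin.zero_le j), h1 ▸ ht.monotone (Fin.le_last j)⟩
    obtain ⟨r, hr, hr'⟩ := intermediate_value_Icc zero_le_one hg.continuous.continuousOn hmem
    exact ⟨r, hr, hr', fun h => absurd h hj0, fun h => absurd h hj1⟩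
  choose u hu hup hu0 hu1 using key
  refine ⟨u, StrictMono.monotone fun i j hij => ?_, hu0 0 h0, hu1 _ h1, hup⟩
  by_contra! h
  have h2 := hg.monotone h
  rw [hup, hup] at h2
  exact absurd (ht hij) (not_lt.2 h2)

lemma partition_mem {n : ℕ} {u : Fin (n + 1) → ℝ} (hu : Monotone u) (h0 : u 0 = 0)
    (h1 : u (Fin.last n) = 1) (j : Fin (n + 1)) : u j ∈ Icc (0 : ℝ) 1 :=
  ⟨h0 ▸ hu (Fin.zero_le j), h1 ▸ hu (Fin.le_last j)⟩

/-- Densities can be prescribed on the intervals of a partition. -/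
lemma exists_density_of_partition {n : ℕ} {u s : Fin (n + 1) → ℝ} (hu : Monotone u) (hu0 : u 0 = 0)
    (hu1 : u (Fin.last n) = 1) (hs0 : s 0 = 0) (hs1 : s (Fin.last n) = 1) {f : Fin n → ℝ → ℝ}
    (hm : ∀ j, Measurable (f j)) (h0 : ∀ j t, 0 ≤ f j t)
    (hi : ∀ j : Fin n, IntegrableOn (f j) (Ioc (u j.castSucc) (u j.succ)))
    (hint : ∀ j : Fin n, ∫ t in u j.castSucc..u j.succ, f j t = s j.succ - s j.castSucc) :
    ∃ g, IsDensity g ∧ (∀ j, prim g (u j) = s j) ∧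
      ∀ j : Fin n, ∀ t ∈ Ioc (u j.castSucc) (u j.succ), g t = f j t := by
  set G : ℝ → ℝ := fun t => ∑ j : Fin n, (Ioc (u j.castSucc) (u j.succ)).indicator (f j) t
  have hG : ∀ j : Fin n, ∀ t ∈ Ioc (u j.castSucc) (u j.succ), G t = f j t := by
    intro j t ht
    have h : G t = (Ioc (u j.castSucc) (u j.succ)).indicator (f j) t := by
      refine Finset.sum_eq_single j (fun i _ hij => ?_) (by simp)
      refine Set.indicator_of_notMem (fun hi' => ?_) _
      rcases lt_or_gt_of_ne hij with h | h
      · have : u i.succ ≤ u j.castSucc := hu (by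
          rw [Fin.le_def]; simp only [Fin.val_succ, Fin.val_castSucc]; omega)
        linarith [hi'.2, ht.1]
      · have : u j.succ ≤ u i.castSucc := hu (by
          rw [Fin.le_def]; simp only [Fin.val_succ, Fin.val_castSucc]; omega)
        linarith [hi'.1, ht.2]
    rw [h, Set.indicator_of_mem ht]
  have hGm : Measurable G :=
    Finset.measurable_fun_sum _ fun j _ => (hm j).indicator measurableSet_Ioc
  have hG0 : ∀ t, 0 ≤ G t := fun t =>
    Finset.sum_nonneg fun j _ => indicator_nonneg (fun t _ => h0 j t) t
  have hGi : Integrable G :=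
    integrable_finsetSum _ fun j _ => (hi j).integrable_indicator measurableSet_Ioc
  have hprim : ∀ j, prim G (u j) = s j := by
    intro j
    induction j using Fin.induction with
    | zero => rw [hu0, hs0, prim_zero]
    | succ j ih =>
      have h1 := prim_sub hGi (u j.castSucc) (u j.succ)
      have h2 : ∫ t in u j.castSucc..u j.succ, G t = s j.succ - s j.castSucc := by
        rw [← hint j]
        refine intervalIntegral.integral_congr_ae (Eventually.of_forall fun t ht => ?_)
        rw [uIoc_of_le (hu j.castSucc_lt_succ.le)] at ht
        exact hG j t ht
      linarith
  have hd := isDensity_indicator_of_integral hGm hG0 hGi.integrableOn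
    (show prim G 1 = 1 by rw [← hu1, hprim, hs1, hu1])
  refine ⟨_, hd, fun j => ?_, fun j t ht => ?_⟩
  · rw [prim_indicator (partition_mem hu hu0 hu1 j), hprim]
  · have h1 := partition_mem hu hu0 hu1 j.castSucc
    have h2 := partition_mem hu hu0 hu1 j.succ
    have hmem : t ∈ Icc (0 : ℝ) 1 := ⟨h1.1.trans ht.1.le, ht.2.trans h2.2⟩
    rw [Set.indicator_of_mem hmem, hG j t ht]

/-! ### The pairing of reparametrizations of an `L²` function and of a step function -/

/-- The square of the positive part of `⟨q, c⟩`. -/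
noncomputable def posSq (q : ℝ → EuclideanSpace ℝ (Fin N)) (c : EuclideanSpace ℝ (Fin N)) :
    ℝ → ℝ :=
  (Icc (0 : ℝ) 1).indicator fun s => max (inner ℝ (q s) c) 0 ^ 2

lemma measurable_inner_coe (q : L2 N) (c : EuclideanSpace ℝ (Fin N)) :
    Measurable fun s => inner ℝ (q s) c :=
  (measurable_coe q).inner measurable_const

lemma measurable_posSq (q : L2 N) (c : EuclideanSpace ℝ (Fin N)) : Measurable (posSq q c) :=
  (((measurable_inner_coe q c).max measurable_const).pow_const 2).indicator measurableSet_Icc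

lemma posSq_nonneg (q : L2 N) (c : EuclideanSpace ℝ (Fin N)) (s : ℝ) : 0 ≤ posSq q c s :=
  indicator_nonneg (fun _ _ => sq_nonneg _) s

lemma integrable_posSq (q : L2 N) (c : EuclideanSpace ℝ (Fin N)) : Integrable (posSq q c) := by
  refine IntegrableOn.integrable_indicator ?_ measurableSet_Icc
  have h := ((Lp.memLp q).norm.integrable_sq).mul_const (‖c‖ ^ 2)
  refine Integrable.mono' h
    (((measurable_inner_coe q c).max measurable_const).pow_const 2).aestronglyMeasurable
    (Eventually.of_forall fun s => ?_)
  rw [Real.norm_eq_abs, abs_of_nonneg (sq_nonneg _), ← mul_pow]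
  refine pow_le_pow_left₀ (le_max_right _ _) (max_le (real_inner_le_norm _ _) (by positivity)) 2

/-- On the `j`-th piece, `w (prim β τ) = c j` almost everywhere outside the zeros of `β`, and at
those zeros both integrands vanish. -/
lemma inner_reparam {α β : ℝ → ℝ} (hα : IsDensity α) (hβ : IsDensity β) (q w : L2 N) {n : ℕ}
    {t u : Fin (n + 1) → ℝ} {c : Fin n → EuclideanSpace ℝ (Fin N)}
    (hw : ∀ j : Fin n, ∀ᵐ s ∂volume.restrict (Ioo (t j.castSucc) (t j.succ)), w s = c j)
    (hu : Monotone u) (hu0 : u 0 = 0) (hu1 : u (Fin.last n) = 1) (hut : ∀ j, prim β (u j) = t j) :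
    inner ℝ (reparam hα q) (reparam hβ w) = ∑ j : Fin n, ∫ τ in u j.castSucc..u j.succ,
      √(β τ) * (√(α τ) * inner ℝ (q (prim α τ)) (c j)) := by
  have hint := L2.integrable_inner (𝕜 := ℝ) (reparam hα q) (reparam hβ w)
  have hsub : ∀ j : Fin n, Ioc (u j.castSucc) (u j.succ) ⊆ Icc (0 : ℝ) 1 := fun j τ hτ =>
    ⟨(partition_mem hu hu0 hu1 j.castSucc).1.trans hτ.1.le,
      hτ.2.trans (partition_mem hu hu0 hu1 j.succ).2⟩
  have hsum := sum_integral_partition (u := u)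
    (f := fun τ => inner ℝ ((reparam hα q : L2 N) τ) ((reparam hβ w : L2 N) τ)) fun j => ?_
  · rw [hu0, hu1] at hsum
    rw [L2.inner_def, integral_Icc_eq_integral_Ioc,
      ← intervalIntegral.integral_of_le zero_le_one, ← hsum]
    refine Finset.sum_congr rfl fun j _ => ?_
    have hle := hu j.castSucc_lt_succ.le
    rw [intervalIntegral.integral_of_le hle, intervalIntegral.integral_of_le hle]
    refine integral_congr_ae ?_
    have hres : ∀ {p : ℝ → Prop}, (∀ᵐ τ ∂volI, p τ) →
        ∀ᵐ τ ∂volume.restrict (Ioc (u j.castSucc) (u j.succ)), p τ := fun h =>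
      ae_restrict_of_ae_restrict_of_subset (hsub j) h
    have hc := ae_comp_prim hβ.measurable hβ.nonneg hβ.integrable hle (p := fun s => w s = c j) (by
      rw [hut, hut, ← Measure.restrict_congr_set Ioo_ae_eq_Ioc]
      exact hw j)
    filter_upwards [hc, hres (coeFn_reparam hα q), hres (coeFn_reparam hβ w)] with τ h1 h2 h3
    rw [h2, h3, reparamFun, reparamFun, inner_smul_left, inner_smul_right]
    by_cases h0 : β τ = 0
    · simp [h0]
    · rw [h1 h0]
      simp only [conj_trivial]
      ring
  · rw [intervalIntegrable_iff_integrableOn_Ioc_of_le (hu j.castSucc_lt_succ.le)]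
    exact IntegrableOn.mono_set hint (hsub j)

lemma integral_mul_le_sqrt_mul_sqrt {μ : Measure ℝ} {f g : ℝ → ℝ} (hf : Measurable f)
    (hg : Measurable g) (hf0 : ∀ t, 0 ≤ f t) (hg0 : ∀ t, 0 ≤ g t)
    (hfi : Integrable (fun t => f t ^ 2) μ) (hgi : Integrable (fun t => g t ^ 2) μ) :
    ∫ t, f t * g t ∂μ ≤ √(∫ t, f t ^ 2 ∂μ) * √(∫ t, g t ^ 2 ∂μ) := by
  have h := integral_mul_le_Lp_mul_Lq_of_nonneg (μ := μ) Real.HolderConjugate.two_two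
    (Eventually.of_forall hf0) (Eventually.of_forall hg0)
    (by simpa using (memLp_two_iff_integrable_sq hf.aestronglyMeasurable).2 hfi)
    (by simpa using (memLp_two_iff_integrable_sq hg.aestronglyMeasurable).2 hgi)
  simpa [Real.sqrt_eq_rpow] using h

/-- Cauchy–Schwarz for `√β` and `√α` times the positive part of the inner product; the integrals of
their squares are then evaluated by the change of variables for `α`. -/
lemma integral_inner_le {α β : ℝ → ℝ} (hα : IsDensity α) (hβ : IsDensity β) (q : L2 N)
    (c : EuclideanSpace ℝ (Fin N)) {u v : ℝ} (hu : 0 ≤ u) (huv : u ≤ v) (hv : v ≤ 1) :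
    ∫ τ in u..v, √(β τ) * (√(α τ) * inner ℝ (q (prim α τ)) c)
      ≤ √(prim β v - prim β u)
        * √(prim (posSq q c) (prim α v) - prim (posSq q c) (prim α u)) := by
  have hqi := integrable_posSq q c
  have hfm : Measurable fun τ => √(β τ) := hβ.measurable.sqrt
  have hgm : Measurable fun τ => √(α τ) * √(posSq q c (prim α τ)) :=
    hα.measurable.sqrt.mul ((measurable_posSq q c).comp hα.continuous.measurable).sqrt
  have hf2 : ∀ τ, √(β τ) ^ 2 = β τ := fun τ => Real.sq_sqrt (hβ.nonneg τ)
  have hg2 : ∀ τ, (√(α τ) * √(posSq q c (prim α τ))) ^ 2 = α τ * posSq q c (prim α τ) := by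
    intro τ
    rw [mul_pow, Real.sq_sqrt (hα.nonneg τ), Real.sq_sqrt (posSq_nonneg q c _)]
  have hfi : Integrable (fun τ => √(β τ) ^ 2) (volume.restrict (Ioc u v)) := by
    simp only [hf2]
    exact hβ.integrable.integrableOn
  have hgi : Integrable (fun τ => (√(α τ) * √(posSq q c (prim α τ))) ^ 2)
      (volume.restrict (Ioc u v)) := by
    simp only [hg2]
    exact integrableOn_comp_prim hα.measurable hα.nonneg hα.integrable huv hqi.integrableOn
  have hCS := integral_mul_le_sqrt_mul_sqrt hfm hgm (fun _ => Real.sqrt_nonneg _)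
    (fun _ => by positivity) hfi hgi
  simp only [hf2, hg2] at hCS
  rw [prim_sub hβ.integrable, prim_sub hqi, ← integral_comp_prim hα.measurable hα.nonneg
    hα.integrable huv (measurable_posSq q c), intervalIntegral.integral_of_le huv,
    intervalIntegral.integral_of_le huv, intervalIntegral.integral_of_le huv]
  refine le_trans ?_ hCS
  by_cases hL : IntegrableOn (fun τ => √(β τ) * (√(α τ) * inner ℝ (q (prim α τ)) c)) (Ioc u v)
  · refine setIntegral_mono_on hL ?_ measurableSet_Ioc fun τ hτ => ?_
    · exact MemLp.integrable_mul
        ((memLp_two_iff_integrable_sq hfm.aestronglyMeasurable).2 hfi)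
        ((memLp_two_iff_integrable_sq hgm.aestronglyMeasurable).2 hgi)
    · have hmem := hα.prim_mem (t := τ) ⟨hu.trans hτ.1.le, hτ.2.trans hv⟩
      rw [posSq, Set.indicator_of_mem hmem, Real.sqrt_sq (le_max_right _ _)]
      gcongr
      exact le_max_left _ _
  -- A nonintegrable integrand has integral `0` by convention, and the bound is nonnegative.
  · rw [integral_undef hL]
    exact integral_nonneg fun τ => by positivity

/-- The supremum of the pairings of reparametrizations of `q` and of a step function with
partition `t` and values `c` that match the partition `s` with the partition `t`. -/
noncomputable def matchValue (q : L2 N) {n : ℕ} (t : Fin (n + 1) → ℝ)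
    (c : Fin n → EuclideanSpace ℝ (Fin N)) (s : Fin (n + 1) → ℝ) : ℝ :=
  ∑ j : Fin n, √(t j.succ - t j.castSucc)
    * √(prim (posSq q (c j)) (s j.succ) - prim (posSq q (c j)) (s j.castSucc))

/-- The partitions of `[0,1]` into `n` possibly degenerate intervals. -/
def partitions (n : ℕ) : Set (Fin (n + 1) → ℝ) :=
  {s | Monotone s ∧ s 0 = 0 ∧ s (Fin.last n) = 1}

lemma isCompact_partitions (n : ℕ) : IsCompact (partitions n) := by
  refine (isCompact_univ_pi fun _ => isCompact_Icc (a := (0 : ℝ)) (b := 1)).of_isClosed_subset ?_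
    fun s hs j _ => partition_mem hs.1 hs.2.1 hs.2.2 j
  refine IsClosed.inter ?_ (IsClosed.inter ?_ ?_)
  · exact isClosed_monotone
  · exact isClosed_eq (continuous_apply _) continuous_const
  · exact isClosed_eq (continuous_apply _) continuous_const

lemma continuous_matchValue (q : L2 N) {n : ℕ} (t : Fin (n + 1) → ℝ)
    (c : Fin n → EuclideanSpace ℝ (Fin N)) : Continuous (matchValue q t c) := by
  refine continuous_finsetSum _ fun j _ => continuous_const.mul ?_
  have h := continuous_prim (integrable_posSq q (c j))
  exact ((h.comp (continuous_apply _)).sub (h.comp (continuous_apply _))).sqrt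

lemma exists_inner_le_matchValue {α β : ℝ → ℝ} (hα : IsDensity α) (hβ : IsDensity β) (q w : L2 N)
    {n : ℕ} {t : Fin (n + 1) → ℝ} {c : Fin n → EuclideanSpace ℝ (Fin N)} (ht : StrictMono t)
    (h0 : t 0 = 0) (h1 : t (Fin.last n) = 1)
    (hw : ∀ j : Fin n, ∀ᵐ s ∂volume.restrict (Ioo (t j.castSucc) (t j.succ)), w s = c j) :
    ∃ s ∈ partitions n, inner ℝ (reparam hα q) (reparam hβ w) ≤ matchValue q t c s := by
  obtain ⟨u, hu, hu0, hu1, hut⟩ := exists_partition_prim_eq hβ ht h0 h1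
  -- These are the parameters that `q` has reached when `w` passes from one step to the next.
  refine ⟨fun j => prim α (u j), ⟨hα.monotone.comp hu, ?_, ?_⟩, ?_⟩
  · simp only [hu0, prim_zero]
  · simp only [hu1, hα.prim_one]
  · rw [inner_reparam hα hβ q w hw hu hu0 hu1 hut]
    refine Finset.sum_le_sum fun j _ => ?_
    rw [← hut, ← hut]
    exact integral_inner_le hα hβ q (c j) (partition_mem hu hu0 hu1 _).1
      (hu j.castSucc_lt_succ.le) (partition_mem hu hu0 hu1 _).2

lemma integral_indicator_Ioc_const {a b u v : ℝ} (huv : u ≤ v) (hab : a ≤ b)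
    (h : Ioc a b ⊆ Ioc u v) (k : ℝ) :
    ∫ t in u..v, (Ioc a b).indicator (fun _ => k) t = (b - a) * k := by
  rw [intervalIntegral.integral_of_le huv, integral_indicator measurableSet_Ioc,
    Measure.restrict_restrict measurableSet_Ioc, inter_eq_self_of_subset_left h]
  simp [hab]

/-- The value `matchValue q t c s` is attained by weakly increasing reparametrizations. On each
interval of `t` the curve `q` runs through its piece during a first part; the step function runs
through its piece along with it if this piece contributes, and during the second part otherwise. -/
lemma exists_inner_eq_matchValue (q w : L2 N) {n : ℕ} {t : Fin (n + 1) → ℝ}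
    {c : Fin n → EuclideanSpace ℝ (Fin N)} (ht : StrictMono t) (h0 : t 0 = 0)
    (h1 : t (Fin.last n) = 1)
    (hw : ∀ j : Fin n, ∀ᵐ s ∂volume.restrict (Ioo (t j.castSucc) (t j.succ)), w s = c j)
    {s : Fin (n + 1) → ℝ} (hs : s ∈ partitions n) :
    ∃ (α β : ℝ → ℝ) (hα : IsDensity α) (hβ : IsDensity β),
      inner ℝ (reparam hα q) (reparam hβ w) = matchValue q t c s := by
  obtain ⟨hs, hs0, hs1⟩ := hs
  have hlt : ∀ j : Fin n, t j.castSucc < t j.succ := fun j => ht j.castSucc_lt_succ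
  have hsle : ∀ j : Fin n, s j.castSucc ≤ s j.succ := fun j => hs j.castSucc_lt_succ.le
  choose m hm1 hm2 using fun j => exists_between (hlt j)
  obtain ⟨α, hα, hαt, hαeq⟩ := exists_density_of_partition ht.monotone h0 h1 hs0 hs1
    (f := fun j => (Ioc (t j.castSucc) (m j)).indicator
      fun _ => (s j.succ - s j.castSucc) / (m j - t j.castSucc))
    (fun j => measurable_const.indicator measurableSet_Ioc)
    (fun j τ => indicator_nonneg (fun _ _ => div_nonneg (sub_nonneg.2 (hsle j))
      (sub_nonneg.2 (hm1 j).le)) τ)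
    (fun j => (integrable_const _).indicator measurableSet_Ioc)
    (fun j => by
      rw [integral_indicator_Ioc_const (hlt j).le (hm1 j).le (Ioc_subset_Ioc_right (hm2 j).le),
        mul_div_cancel₀ _ (sub_pos.2 (hm1 j)).ne'])
  set ψ : Fin n → ℝ → ℝ := fun j => posSq q (c j)
  set mass : Fin n → ℝ := fun j => prim (ψ j) (s j.succ) - prim (ψ j) (s j.castSucc)
  have hmass0 : ∀ j, 0 ≤ mass j := fun j =>
    sub_nonneg.2 (monotone_prim (posSq_nonneg q (c j)) (integrable_posSq q (c j)) (hsle j))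
  have hmass : ∀ j : Fin n, ∫ τ in t j.castSucc..t j.succ, α τ * ψ j (prim α τ) = mass j := by
    intro j
    rw [integral_comp_prim hα.measurable hα.nonneg hα.integrable (hlt j).le
      (measurable_posSq q (c j)), hαt, hαt, ← prim_sub (integrable_posSq q (c j))]
  -- Equality in Cauchy–Schwarz forces `β` to be proportional to `α τ * ψ j (prim α τ)`, normalized
  -- by `mass j`. If `mass j = 0`, the mass of `β` goes after `m j`, where `α` vanishes, so that
  -- negative values of the inner product do no harm.
  obtain ⟨β, hβ, hβt, hβeq⟩ := exists_density_of_partition ht.monotone h0 h1 h0 h1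
    (f := fun j => if mass j = 0 then (Ioc (m j) (t j.succ)).indicator
        fun _ => (t j.succ - t j.castSucc) / (t j.succ - m j)
      else fun τ => (t j.succ - t j.castSucc) / mass j * (α τ * ψ j (prim α τ)))
    (fun j => by
      split_ifs
      · exact measurable_const.indicator measurableSet_Ioc
      · exact (hα.measurable.mul ((measurable_posSq q (c j)).comp
          hα.continuous.measurable)).const_mul _)
    (fun j τ => by
      split_ifs
      · exact indicator_nonneg (fun _ _ => div_nonneg (sub_nonneg.2 (hlt j).le)
          (sub_nonneg.2 (hm2 j).le)) τ
      · exact mul_nonneg (div_nonneg (sub_nonneg.2 (hlt j).le) (hmass0 j))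
          (mul_nonneg (hα.nonneg τ) (posSq_nonneg q (c j) _)))
    (fun j => by
      split_ifs
      · exact (integrable_const _).indicator measurableSet_Ioc
      · exact (integrableOn_comp_prim hα.measurable hα.nonneg hα.integrable (hlt j).le
          (integrable_posSq q (c j)).integrableOn).const_mul _)
    (fun j => by
      split_ifs with h
      · rw [integral_indicator_Ioc_const (hlt j).le (hm2 j).le (Ioc_subset_Ioc_left (hm1 j).le),
          mul_div_cancel₀ _ (sub_pos.2 (hm2 j)).ne']
      · rw [intervalIntegral.integral_const_mul, hmass, div_mul_cancel₀ _ h])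
  refine ⟨α, β, hα, hβ, ?_⟩
  rw [inner_reparam hα hβ q w hw ht.monotone h0 h1 hβt]
  refine Finset.sum_congr rfl fun j _ => ?_
  change _ = √(t j.succ - t j.castSucc) * √(mass j)
  by_cases h : mass j = 0
  · rw [h, Real.sqrt_zero, mul_zero]
    refine intervalIntegral.integral_zero_ae (Eventually.of_forall fun τ hτ => ?_)
    rw [uIoc_of_le (hlt j).le] at hτ
    rcases le_or_gt τ (m j) with hτm | hτm
    · have : β τ = 0 := by
        rw [hβeq j τ hτ, if_pos h]
        exact Set.indicator_of_notMem (fun h' => not_lt.2 hτm h'.1) _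
      simp [this]
    · have : α τ = 0 := by
        rw [hαeq j τ hτ]
        exact Set.indicator_of_notMem (fun h' => not_le.2 hτm h'.2) _
      simp [this]
  · have hk : 0 ≤ (t j.succ - t j.castSucc) / mass j :=
      div_nonneg (sub_nonneg.2 (hlt j).le) (hmass0 j)
    have hpt : ∀ τ ∈ uIoc (t j.castSucc) (t j.succ),
        √(β τ) * (√(α τ) * inner ℝ (q (prim α τ)) (c j))
          = √((t j.succ - t j.castSucc) / mass j) * (α τ * ψ j (prim α τ)) := by
      intro τ hτ
      rw [uIoc_of_le (hlt j).le] at hτ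
      have hmem : prim α τ ∈ Icc (0 : ℝ) 1 := hα.prim_mem
        ⟨(partition_mem ht.monotone h0 h1 j.castSucc).1.trans hτ.1.le,
          hτ.2.trans (partition_mem ht.monotone h0 h1 j.succ).2⟩
      have hψ : ψ j (prim α τ) = max (inner ℝ (q (prim α τ)) (c j)) 0 ^ 2 :=
        Set.indicator_of_mem hmem _
      rw [hβeq j τ hτ, if_neg h, Real.sqrt_mul hk, Real.sqrt_mul (hα.nonneg τ), hψ,
        Real.sqrt_sq (le_max_right _ _)]
      -- Where the inner product is negative, `β` vanishes; hence only the positive part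
      -- contributes.
      have h2 : max (inner ℝ (q (prim α τ)) (c j)) 0 * inner ℝ (q (prim α τ)) (c j)
          = max (inner ℝ (q (prim α τ)) (c j)) 0 ^ 2 := by
        rcases le_total (inner ℝ (q (prim α τ)) (c j)) 0 with h3 | h3
        · simp [max_eq_right h3]
        · rw [max_eq_left h3, sq]
      have h3 := Real.mul_self_sqrt (hα.nonneg τ)
      rw [← h2]
      nth_rw 3 [← h3]
      ring
    rw [intervalIntegral.integral_congr_ae (Eventually.of_forall hpt),
      intervalIntegral.integral_const_mul, hmass, Real.sqrt_div (sub_nonneg.2 (hlt j).le)]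
    have h4 := Real.mul_self_sqrt (hmass0 j)
    have h5 : √(mass j) ≠ 0 := (Real.sqrt_pos.2 (lt_of_le_of_ne (hmass0 j) (Ne.symm h))).ne'
    nth_rw 2 [← h4]
    field_simp

/-! ### Closest points of two orbit closures -/

lemma partitions_nonempty {n : ℕ} {t : Fin (n + 1) → ℝ} (ht : StrictMono t) (h0 : t 0 = 0)
    (h1 : t (Fin.last n) = 1) : (partitions n).Nonempty :=
  ⟨t, ht.monotone, h0, h1⟩

/-- Isometries fix the norms of `q` and `w`, so only the inner product varies in the expansion of
the squared distance. -/
lemma dist_reparam_le_of_inner_le {α β g h : ℝ → ℝ} (hα : IsDensity α) (hβ : IsDensity β)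
    (hg : IsDensity g) (hh : IsDensity h) {q w : L2 N}
    (hle : inner ℝ (reparam hg q) (reparam hh w) ≤ inner ℝ (reparam hα q) (reparam hβ w)) :
    dist (reparam hα q) (reparam hβ w) ≤ dist (reparam hg q) (reparam hh w) := by
  rw [dist_eq_norm, dist_eq_norm, ← sq_le_sq₀ (norm_nonneg _) (norm_nonneg _), norm_sub_sq_real,
    norm_sub_sq_real, LinearIsometry.norm_map, LinearIsometry.norm_map, LinearIsometry.norm_map,
    LinearIsometry.norm_map]
  linarith

lemma le_dist_of_mem_closure {X : Type*} [PseudoMetricSpace X] {A B : Set X} {d : ℝ}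
    (h : ∀ a ∈ A, ∀ b ∈ B, d ≤ dist a b) {a b : X} (ha : a ∈ closure A) (hb : b ∈ closure B) :
    d ≤ dist a b := by
  have hmem : (a, b) ∈ closure (A ×ˢ B) := by
    rw [closure_prod_eq]
    exact ⟨ha, hb⟩
  have hcl : IsClosed {x : X × X | d ≤ dist x.1 x.2} :=
    isClosed_le continuous_const (continuous_fst.dist continuous_snd)
  exact closure_minimal (fun x hx => h _ hx.1 _ hx.2) hcl hmem

/-- The orbits of an `L²` function and of a step function have closest points in the closures. -/
lemma exists_dist_reparam_le (q w : L2 N) (hw : IsStep w) :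
    ∃ (α β : ℝ → ℝ) (hα : IsDensity α) (hβ : IsDensity β), ∀ p ∈ closure (orbit q),
      ∀ v ∈ closure (orbit w), dist (reparam hα q) (reparam hβ w) ≤ dist p v := by
  obtain ⟨n, t, c, ht, h0, h1, hc⟩ := hw
  obtain ⟨s, hs, hmax⟩ := (isCompact_partitions n).exists_isMaxOn (partitions_nonempty ht h0 h1)
    (continuous_matchValue q t c).continuousOn
  obtain ⟨α, β, hα, hβ, hαβ⟩ := exists_inner_eq_matchValue q w ht h0 h1 hc hs
  refine ⟨α, β, hα, hβ, fun p hp v hv => ?_⟩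
  have key : ∀ p ∈ orbit q, ∀ v ∈ orbit w, dist (reparam hα q) (reparam hβ w) ≤ dist p v := by
    intro p hp v hv
    obtain ⟨g, hg, rfl⟩ := mem_orbit_iff.1 hp
    obtain ⟨h, hh, rfl⟩ := mem_orbit_iff.1 hv
    obtain ⟨s', hs', hle⟩ :=
      exists_inner_le_matchValue hg.toIsDensity hh.toIsDensity q w ht h0 h1 hc
    have hle' : matchValue q t c s' ≤ matchValue q t c s := hmax hs'
    exact dist_reparam_le_of_inner_le hα hβ hg.toIsDensity hh.toIsDensity
      (hle.trans (hle'.trans hαβ.ge))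
  exact le_dist_of_mem_closure key hp hv

end SRVF

theorem mainTheorem2 (N : ℕ) (x y : SRVF.ShapeSpace N) (hy : y ∈ SRVF.stepShapes N) :
    ∃ q ∈ x.carrier, ∃ w ∈ y.carrier, dist q w = SRVF.shapeDist x y := by
  obtain ⟨w, hw, hstep⟩ := hy
  obtain ⟨q, hq⟩ := Quotient.exists_rep x
  replace hq : SRVF.cls q = x := hq
  replace hw : SRVF.cls w = y := hw
  obtain ⟨α, β, hα, hβ, h⟩ := SRVF.exists_dist_reparam_le q w hstep
  have hqm : SRVF.reparam hα q ∈ x.carrier := (SRVF.cls_reparam hα q).trans hq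
  have hwm : SRVF.reparam hβ w ∈ y.carrier := (SRVF.cls_reparam hβ w).trans hw
  -- The distance attained is the least element of the set that defines `shapeDist`, since each
  -- class lies in the closure of an orbit.
  refine ⟨_, hqm, _, hwm, Eq.symm (IsLeast.csInf_eq ⟨⟨_, hqm, _, hwm, rfl⟩, ?_⟩)⟩
  rintro r ⟨p, hp, v, hv, rfl⟩
  exact h p (SRVF.mem_closure_orbit_of_cls_eq (Eq.trans hp hq.symm))
    v (SRVF.mem_closure_orbit_of_cls_eq (Eq.trans hv hw.symm))
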